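/- Let $P$ be a monoid with unit group $P^*$. For finite $F\subseteq P$ let $\vee F=\{r\in P:\bigcap_{x\in F}xP=rP\}$ (the empty intersection being $P$), and write $p\vee q=\vee\{p,q\}$. $P$ is *right LCM* if it is left cancellative and each $pP\cap qP$ is either empty or of the form $rP$. $P$ satisfies the *descending chain condition* if there are no infinite sequences $x_n\in P$, $y_n\in P\setminus P^*$ such that for every $n$, $x_n=x_{n+1}y_n$ or $x_n=y_nx_{n+1}$. An element $x\notin P^*$ is *minimal* if $x=yz$ implies $y\in P^*$ or $z\in P^*$; $P_{min}$ is the set of minimal elements. A subset $P_0$ of a right LCM monoid is a *minimal set* if $P_{min}\subseteq P_0$ and $x^{-1}(x\vee y)\subseteq P_0\cup P^*$ for all $x\in P_{min}$, $y\in P_0$. Let $T:P\to B(\mathcal H)$ be a unital contractive representation of a right LCM monoid on a complex Hilbert space. Put $K(p,q)=T(p^{-1}s)T(q^{-1}s)^*$ for $s\in p\vee q$, and $K(p,q)=0$ if $p\vee q=\emptyset$. We say that $T$ *has a $\ast$-regular dilation* if $K$ is completely positive definite, i.e. for all $p_1,\dots,p_n\in P$ the operator matrix $[K(p_i,p_j)]$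 is positive on $\mathcal H^n$. For finite $F\subseteq P$ put $$Z(F)=\sum_{U\subseteq F}(-1)^{|U|}\,TT^*(\vee U),$$ where $TT^*(\vee U)=T(s)T(s)^*$ for $s\in\vee U$, and $TT^*(\vee U)=0$ if $\vee U=\emptyset$. **Theorem.** Let $F^+=\langle x_0,x_1,\dots\mid x_nx_k=x_kx_{n+1},\ k<n\rangle$ be Thompson's monoid. Then: 1. $F^+$ is right LCM and satisfies the descending chain condition. 2. The set of minimal elements of $F^+$ is the set of generators $\{x_0,x_1,\dots\}$, and this set is also a minimal set for $F^+$. 3. $x_i\vee x_j=\{x_jx_i\}$ for all $i<j$. 4. A unital contractive representation $T:F^+\to B(\mathcal H)$ on a complex Hilbert space $\mathcal H$ has a $\ast$-regular dilation if and only if $Z(F)\ge 0$ for every finite subset $F$ of $\{x_0,x_1,\dots\}$. -/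

import Mathlib

namespace RightLCM

section Semigroup

variable {P : Type*} [Monoid P]

/-- The principal right ideal `pP`. -/
def rightIdeal (p : P) : Set P := Set.range fun a => p * a

/-- The set `∨F = {r : ⋂ x ∈ F, xP = rP}` of least common right multiples of `F`.
In particular `∨∅` is the set of `r` with `rP = P`, and `p ∨ q` is `join {p, q}`. -/
def join (F : Set P) : Set P := {r | ⋂ x ∈ F, rightIdeal x = rightIdeal r}

variable (P) in
/-- Right LCM semigroups: unital, left cancellative, and any intersection `pP ∩ qP` is either empty
or a principal right ideal. -/
def IsRightLCM : Prop :=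
  (∀ p a b : P, p * a = p * b → a = b) ∧
    ∀ p q : P, (∃ r : P, rightIdeal p ∩ rightIdeal q = rightIdeal r) ∨
      rightIdeal p ∩ rightIdeal q = ∅

variable (P) in
/-- The descending chain condition: one cannot remove non-invertible factors, each time from the
left or from the right, infinitely often. -/
def DescendingChainCondition : Prop :=
  ¬ ∃ x y : ℕ → P, ∀ n, ¬ IsUnit (y n) ∧ (x n = x (n + 1) * y n ∨ x n = y n * x (n + 1))

variable (P) in
/-- The set `P_min` of minimal elements: `x` is not invertible, and `x = y * z` forces `y` or `z`
to be invertible. -/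
def minimalElements : Set P := {x | Irreducible x}

/-- `P₀` is a minimal set: it contains all the minimal elements, and `x⁻¹(x ∨ y) ⊆ P₀ ∪ P*` for
every minimal `x` and every `y ∈ P₀`; here `a ∈ x⁻¹(x ∨ y)` means `x * a ∈ x ∨ y`. -/
def IsMinimalSet (P₀ : Set P) : Prop :=
  minimalElements P ⊆ P₀ ∧
    ∀ x ∈ minimalElements P, ∀ y ∈ P₀, ∀ a : P, x * a ∈ join {x, y} → a ∈ P₀ ∨ IsUnit a

open Classical in
/-- The left quotient `p⁻¹s`, for `s ∈ pP`. It is only used in left cancellative monoids, where it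
is unique, and for `s ∈ pP`. -/
noncomputable def leftQuot (p s : P) : P := if h : ∃ a, p * a = s then h.choose else 1

theorem mul_leftQuot {p s : P} (h : s ∈ rightIdeal p) : p * leftQuot p s = s := by
  have h' : ∃ a, p * a = s := h
  rw [leftQuot, dif_pos h']
  exact h'.choose_spec

end Semigroup

section Operators

variable {P : Type*} [Monoid P] {H : Type*} [NormedAddCommGroup H] [InnerProductSpace ℂ H]

open scoped ComplexOrder in
/-- A kernel `K : P × P → B(H)` is completely positive definite if every operator matrix
`[K(p_i, p_j)]`, acting on `H^n`, is positive. -/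
def IsCompletelyPositiveDefinite (K : P → P → (H →L[ℂ] H)) : Prop :=
  ∀ (n : ℕ) (p : Fin n → P) (h : Fin n → H),
    0 ≤ ∑ i, ∑ j, inner ℂ (h i) (K (p i) (p j) (h j))

variable [CompleteSpace H]

open Classical in
/-- The kernel `K(p,q) = T(p⁻¹s) T(q⁻¹s)*` for `s ∈ p ∨ q`, and `K(p,q) = 0` if `p ∨ q = ∅`. For a
contractive unital representation of a right LCM semigroup the choice of `s` is immaterial. -/
noncomputable def regularKernel (T : P →* (H →L[ℂ] H)) (p q : P) : H →L[ℂ] H :=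
  if h : (join {p, q}).Nonempty then
    T (leftQuot p h.some) * ContinuousLinearMap.adjoint (T (leftQuot q h.some))
  else 0

/-- `T` has a `*`-regular dilation if its kernel `K` is completely positive definite. -/
def HasStarRegularDilation (T : P →* (H →L[ℂ] H)) : Prop :=
  IsCompletelyPositiveDefinite (regularKernel T)

open Classical in
/-- `TT*(∨U) = T(s) T(s)*` for `s ∈ ∨U`, and `0` if `∨U = ∅`. -/
noncomputable def rangeJoin (T : P →* (H →L[ℂ] H)) (U : Finset P) : H →L[ℂ] H :=
  if h : (join (U : Set P)).Nonempty then T h.some * ContinuousLinearMap.adjoint (T h.some) else 0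

/-- `Z(F) = ∑_{U ⊆ F} (-1)^{|U|} TT*(∨U)`. -/
noncomputable def brehmerSum (T : P →* (H →L[ℂ] H)) (F : Finset P) : H →L[ℂ] H :=
  ∑ U ∈ F.powerset, (-1 : ℂ) ^ U.card • rangeJoin T U

end Operators

/-- The defining relations `x_n x_k = x_k x_{n+1}`, `k < n`, of Thompson's monoid. -/
inductive ThompsonRel : FreeMonoid ℕ → FreeMonoid ℕ → Prop
  | rel (n k : ℕ) (h : k < n) :
      ThompsonRel (FreeMonoid.of n * FreeMonoid.of k) (FreeMonoid.of k * FreeMonoid.of (n + 1))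

/-- Thompson's monoid `F⁺ = ⟨x₀, x₁, … | x_n x_k = x_k x_{n+1}, k < n⟩`. -/
abbrev ThompsonMonoid : Type := PresentedMonoid ThompsonRel

/-- The generator `x_n` of Thompson's monoid. -/
def thompsonGen (n : ℕ) : ThompsonMonoid := PresentedMonoid.of ThompsonRel n

end RightLCM

/-! Words in the generators have faithful normal forms, obtained by moving small letters left. They
show that F⁺ is left cancellative and that, for i < j, a common multiple of x_i and x_j is a
multiple of x_j x_i = x_i x_{j+1}. So residuals of distinct generators are generators, any two
elements have a least common right multiple, and p⁻¹(p ∨ q) is no longer than q. Length also gives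
trivial units, the chain condition and the minimal elements.

For the dilation criterion, Möbius inversion over finite sets writes K as a sum of pieces A_i Z A_j*
with Z a Brehmer sum (`regularKernel_eq_sum`), so K is positive once all Brehmer sums are.
Conversely, testing K on the elements ∨U with vectors (-1)^{|U|} T(∨U)* h returns ⟨h, Z(F) h⟩. To
need only generators, a product xy in a family is split by `familyBrehmerSum_mul` into two Brehmer
sums of smaller total length, the second conjugated by T(x). -/

namespace RightLCM

/-! ### Residuals and least common multiples -/

section Residual

/-- Left cancellative monoids in which left divisibility is antisymmetric and any two elements have
a least common right multiple, the latter expressed through the residual `r = p⁻¹(p ∨ q)`. -/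
class ResidualMonoid (P : Type*) [Monoid P] : Prop where
  mul_left_cancel : ∀ p a b : P, p * a = p * b → a = b
  dvd_antisymm : ∀ p q : P, p ∣ q → q ∣ p → p = q
  exists_residual : ∀ p q : P, ∃ r : P, ∀ t, r ∣ t ↔ q ∣ p * t

variable {P : Type*} [Monoid P]

theorem mem_rightIdeal {p s : P} : s ∈ rightIdeal p ↔ p ∣ s :=
  ⟨fun ⟨a, h⟩ => ⟨a, h.symm⟩, fun ⟨a, h⟩ => ⟨a, h.symm⟩⟩

theorem mem_join_iff {S : Set P} {r : P} : r ∈ join S ↔ ∀ t, r ∣ t ↔ ∀ x ∈ S, x ∣ t := by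
  simp only [join, Set.mem_ofPred_eq, Set.ext_iff, Set.mem_iInter, mem_rightIdeal]
  exact forall_congr' fun t => Iff.comm

theorem mul_leftQuot_of_dvd {p s : P} (h : p ∣ s) : p * leftQuot p s = s :=
  mul_leftQuot (mem_rightIdeal.2 h)

variable [ResidualMonoid P]

/-- An element is determined by its set of multiples; the identities for residuals and LCMs below
are checked on multiples. -/
theorem eq_of_dvd_iff {p q : P} (h : ∀ t, p ∣ t ↔ q ∣ t) : p = q :=
  ResidualMonoid.dvd_antisymm _ _ ((h q).2 dvd_rfl) ((h p).1 dvd_rfl)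

theorem mul_dvd_mul_left_iff_of_residual {p a b : P} : p * a ∣ p * b ↔ a ∣ b := by
  refine ⟨fun ⟨c, hc⟩ => ⟨c, ?_⟩, mul_dvd_mul_left p⟩
  exact ResidualMonoid.mul_left_cancel p _ _ (by rw [hc, mul_assoc])

theorem isUnit_iff_eq_one {p : P} : IsUnit p ↔ p = 1 := by
  refine ⟨fun h => ?_, fun h => h ▸ isUnit_one⟩
  obtain ⟨b, hb⟩ := h.exists_right_inv
  exact ResidualMonoid.dvd_antisymm _ _ ⟨b, hb.symm⟩ (one_dvd p)

/-- The residual `p⁻¹(p ∨ q)`. -/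
noncomputable def residual (p q : P) : P := (ResidualMonoid.exists_residual p q).choose

theorem residual_dvd_iff {p q t : P} : residual p q ∣ t ↔ q ∣ p * t :=
  (ResidualMonoid.exists_residual p q).choose_spec t

@[simp]
theorem residual_self (p : P) : residual p p = 1 :=
  eq_of_dvd_iff fun t => by simp [residual_dvd_iff]

theorem residual_mul (x y z : P) : residual (x * y) z = residual y (residual x z) :=
  eq_of_dvd_iff fun t => by simp [residual_dvd_iff, mul_assoc]

theorem residual_one (z : P) : residual 1 z = z :=
  eq_of_dvd_iff fun t => by simp [residual_dvd_iff]

theorem mul_residual_dvd_iff {p q t : P} : p * residual p q ∣ t ↔ p ∣ t ∧ q ∣ t := by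
  constructor
  · intro h
    exact ⟨(dvd_mul_right _ _).trans h, (residual_dvd_iff.1 dvd_rfl).trans h⟩
  · rintro ⟨⟨c, rfl⟩, h⟩
    rwa [mul_dvd_mul_left_iff_of_residual, residual_dvd_iff]

theorem join_pair (p q : P) : join {p, q} = {p * residual p q} := by
  ext r
  rw [mem_join_iff, Set.mem_singleton_iff]
  constructor
  · intro h
    exact eq_of_dvd_iff fun t => by rw [h, mul_residual_dvd_iff]; simp
  · rintro rfl t
    rw [mul_residual_dvd_iff]; simp

theorem isRightLCM_of_residualMonoid : IsRightLCM P := by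
  refine ⟨ResidualMonoid.mul_left_cancel, fun p q => Or.inl ⟨p * residual p q, ?_⟩⟩
  ext t
  simp [mem_rightIdeal, mul_residual_dvd_iff]

theorem leftQuot_mul_of_dvd {p s : P} (h : p ∣ s) (c : P) :
    leftQuot p (s * c) = leftQuot p s * c := by
  apply ResidualMonoid.mul_left_cancel p
  rw [mul_leftQuot_of_dvd (h.trans (dvd_mul_right _ _)), ← mul_assoc, mul_leftQuot_of_dvd h]

variable {ι : Type*}

theorem exists_familyLCM (U : Finset ι) (p : ι → P) :
    ∃ r : P, ∀ t, r ∣ t ↔ ∀ i ∈ U, p i ∣ t := by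
  classical
  induction U using Finset.induction_on with
  | empty => exact ⟨1, fun t => by simp⟩
  | insert a U _ ih =>
    obtain ⟨r, hr⟩ := ih
    exact ⟨p a * residual (p a) r, fun t => by
      rw [mul_residual_dvd_iff, hr, Finset.forall_mem_insert]⟩

/-- The least common right multiple of the elements `p i`, `i ∈ U`. -/
noncomputable def familyLCM (U : Finset ι) (p : ι → P) : P := (exists_familyLCM U p).choose

theorem familyLCM_dvd_iff {U : Finset ι} {p : ι → P} {t : P} :
    familyLCM U p ∣ t ↔ ∀ i ∈ U, p i ∣ t :=
  (exists_familyLCM U p).choose_spec t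

theorem dvd_familyLCM {U : Finset ι} (p : ι → P) {i : ι} (hi : i ∈ U) : p i ∣ familyLCM U p :=
  familyLCM_dvd_iff.1 dvd_rfl i hi

theorem familyLCM_congr {U : Finset ι} {p q : ι → P} (h : ∀ i ∈ U, p i = q i) :
    familyLCM U p = familyLCM U q :=
  eq_of_dvd_iff fun t => by
    simp only [familyLCM_dvd_iff]
    exact forall₂_congr fun i hi => by rw [h i hi]

/-- Among the multiples s * c of s = ∨S, those divisible by p i are the ones with c divisible by the
residual of p i. This factorization is what pulls T(s) out of Brehmer sums. -/
theorem familyLCM_union [DecidableEq ι] (S U : Finset ι) (p : ι → P) :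
    familyLCM (S ∪ U) p =
      familyLCM S p * familyLCM U (fun i => residual (familyLCM S p) (p i)) := by
  refine eq_of_dvd_iff fun t => ?_
  constructor
  · intro h
    have hS : familyLCM S p ∣ t := (familyLCM_dvd_iff.2 fun i hi =>
      (dvd_familyLCM p (Finset.mem_union_left U hi)).trans h)
    obtain ⟨c, rfl⟩ := hS
    rw [mul_dvd_mul_left_iff_of_residual, familyLCM_dvd_iff]
    intro i hi
    rw [residual_dvd_iff]
    exact (dvd_familyLCM p (Finset.mem_union_right S hi)).trans h
  · rintro ⟨c, rfl⟩
    rw [familyLCM_dvd_iff]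
    intro i hi
    rcases Finset.mem_union.1 hi with hi | hi
    · rw [mul_assoc]
      exact (dvd_familyLCM p hi).trans (dvd_mul_right _ _)
    · rw [mul_assoc, ← residual_dvd_iff]
      exact (dvd_familyLCM _ hi).trans (dvd_mul_right _ _)

theorem familyLCM_singleton (a : ι) (p : ι → P) : familyLCM {a} p = p a :=
  eq_of_dvd_iff fun t => by simp [familyLCM_dvd_iff]

theorem familyLCM_insert [DecidableEq ι] (a : ι) (U : Finset ι) (p : ι → P) :
    familyLCM (insert a U) p = p a * familyLCM U (fun i => residual (p a) (p i)) := by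
  rw [Finset.insert_eq, familyLCM_union, familyLCM_singleton]

theorem join_image [DecidableEq P] (U : Finset ι) (p : ι → P) :
    join (U.image p : Set P) = {familyLCM U p} := by
  ext r
  rw [mem_join_iff, Set.mem_singleton_iff]
  have key : ∀ t, (∀ x ∈ (U.image p : Set P), x ∣ t) ↔ familyLCM U p ∣ t := fun t => by
    simp [familyLCM_dvd_iff]
  simp only [key]
  exact ⟨eq_of_dvd_iff, fun h t => by rw [h]⟩

end Residual

/-! ### Normal forms, length and residuals in Thompson's monoid -/

section Thompson

/-- The left multiplication by the `n`-th generator on words in the generators, where a word is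
represented by moving small letters to the left. -/
def insertLetter : ℕ → List ℕ → List ℕ
  | n, [] => [n]
  | n, k :: w => if k < n then k :: insertLetter (n + 1) w else n :: k :: w

/-- The defining relation holds on all words, sorted or not, so the presented monoid acts on lists.
-/
theorem insertLetter_comm {n k : ℕ} (h : k < n) (w : List ℕ) :
    insertLetter n (insertLetter k w) = insertLetter k (insertLetter (n + 1) w) := by
  induction w generalizing n k with
  | nil => simp [insertLetter, h, show ¬ n + 1 < k by omega]
  | cons j w ih =>
    rcases lt_or_ge j k with hj | hj
    · have h1 : j < n := hj.trans h
      simp [insertLetter, hj, h1, show j < n + 1 by omega, ih (show k + 1 < n + 1 by omega)]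
    · rcases lt_or_ge j (n + 1) with hn | hn
      · simp [insertLetter, h, hn, hj.not_gt]
      · simp [insertLetter, h, hn.not_gt, hj.not_gt, show ¬ n + 1 < k by omega]

theorem insertLetter_ne_nil (n : ℕ) (w : List ℕ) : insertLetter n w ≠ [] := by
  cases w with
  | nil => simp [insertLetter]
  | cons k w => by_cases h : k < n <;> simp [insertLetter, h]

theorem insertLetter_injective (n : ℕ) : Function.Injective (insertLetter n) := by
  intro u v
  induction u generalizing n v with
  | nil =>
    intro h
    cases v with
    | nil => rfl
    | cons k v =>
      by_cases hk : k < n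
      · simp [insertLetter, hk] at h; omega
      · simp [insertLetter, hk] at h
  | cons j u ih =>
    intro h
    cases v with
    | nil =>
      by_cases hj : j < n
      · simp [insertLetter, hj] at h; omega
      · simp [insertLetter, hj] at h
    | cons k v =>
      by_cases hj : j < n <;> by_cases hk : k < n <;> simp [insertLetter, hj, hk] at h
      · rw [h.1, ih _ h.2]
      · omega
      · omega
      · rw [h.1, h.2]

/-- The combinatorial core of the LCM of two generators: if x_i a = x_j b with i < j, then x_i
already divides b. -/
theorem exists_eq_insertLetter {i j : ℕ} (hij : i < j) {u v : List ℕ}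
    (h : insertLetter i u = insertLetter j v) : ∃ w, v = insertLetter i w := by
  induction v generalizing i j u with
  | nil =>
    cases u with
    | nil => simp [insertLetter] at h; omega
    | cons m u => by_cases hm : m < i <;> simp [insertLetter, hm] at h; omega
  | cons k v ih =>
    by_cases hk : k < j
    · cases u with
      | nil =>
        simp only [insertLetter, hk, if_true, List.cons.injEq] at h
        exact absurd h.2.symm (insertLetter_ne_nil _ _)
      | cons m u =>
        by_cases hm : m < i
        · simp only [insertLetter, hm, hk, if_true, List.cons.injEq] at h
          obtain ⟨w, rfl⟩ := ih (by omega) h.2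
          exact ⟨m :: w, by simp [insertLetter, hm, ← h.1]⟩
        · simp only [insertLetter, hm, hk, if_true, if_false, List.cons.injEq] at h
          obtain ⟨rfl, h⟩ := h
          -- The tail works provided its first letter is at least i. A smaller letter would stay in
          -- front when j + 1 is inserted, hence equal m, which is not below i.
          refine ⟨v, ?_⟩
          cases v with
          | nil => simp [insertLetter]
          | cons l v =>
            have hl : ¬ l < i := by
              by_cases hl : l < j + 1 <;> simp [insertLetter, hl] at h <;> omega
            simp [insertLetter, hl]
    · cases u with
      | nil => simp [insertLetter, hk] at h
      | cons m u => by_cases hm : m < i <;> simp [insertLetter, hm, hk] at h <;> omega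

theorem thompsonGen_mul {n k : ℕ} (h : k < n) :
    thompsonGen n * thompsonGen k = thompsonGen k * thompsonGen (n + 1) :=
  PresentedMonoid.mk_eq_mk_of_rel (ThompsonRel.rel n k h)

/-- The action of Thompson's monoid on words. -/
def wordAction : ThompsonMonoid →* Function.End (List ℕ) :=
  PresentedMonoid.lift (M := Function.End (List ℕ)) insertLetter (by
    rintro _ _ ⟨n, k, h⟩
    simp only [map_mul]
    funext w
    exact insertLetter_comm h w)

/-- The normal form of an element of Thompson's monoid. -/
def normalForm (p : ThompsonMonoid) : List ℕ := wordAction p []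

theorem normalForm_gen_mul (n : ℕ) (p : ThompsonMonoid) :
    normalForm (thompsonGen n * p) = insertLetter n (normalForm p) := by
  rw [normalForm, map_mul]
  rfl

/-- The element of Thompson's monoid spelled by a word. -/
def wordProd (w : List ℕ) : ThompsonMonoid := (w.map thompsonGen).prod

theorem wordProd_insertLetter (n : ℕ) (w : List ℕ) :
    wordProd (insertLetter n w) = thompsonGen n * wordProd w := by
  induction w generalizing n with
  | nil => simp [wordProd, insertLetter]
  | cons k w ih =>
    by_cases h : k < n
    · have := ih (n + 1)
      simp only [wordProd] at this
      simp only [insertLetter, h, if_true, wordProd, List.map_cons, List.prod_cons, this]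
      rw [← mul_assoc, ← mul_assoc, thompsonGen_mul h]
    · simp [insertLetter, h, wordProd]

@[elab_as_elim]
theorem thompson_induction {C : ThompsonMonoid → Prop} (p : ThompsonMonoid) (one : C 1)
    (gen_mul : ∀ n q, C q → C (thompsonGen n * q)) : C p := by
  have hp : p ∈ Submonoid.closure (Set.range (PresentedMonoid.of ThompsonRel)) := by
    rw [PresentedMonoid.closure_range_of]; trivial
  induction hp using Submonoid.closure_induction_left with
  | one => exact one
  | mul_left x hx y _ ih =>
    obtain ⟨n, rfl⟩ := hx
    exact gen_mul n y ih

/-- Spelling out the normal form recovers the element, so equations in the monoid can be tested on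
words. -/
theorem wordProd_normalForm (p : ThompsonMonoid) : wordProd (normalForm p) = p := by
  induction p using thompson_induction with
  | one => rw [normalForm, map_one]; rfl
  | gen_mul n q ih => rw [normalForm_gen_mul, wordProd_insertLetter, ih]

theorem normalForm_injective : Function.Injective normalForm :=
  Function.LeftInverse.injective wordProd_normalForm

theorem thompson_mul_left_cancel (p a b : ThompsonMonoid) (h : p * a = p * b) : a = b := by
  induction p using thompson_induction with
  | one => simpa using h
  | gen_mul n q ih =>
    rw [mul_assoc, mul_assoc] at h
    have h' := congrArg normalForm h
    rw [normalForm_gen_mul, normalForm_gen_mul] at h'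
    exact ih (normalForm_injective (insertLetter_injective n h'))

/-- The length homomorphism. -/
def thompsonLengthHom : ThompsonMonoid →* Multiplicative ℕ :=
  PresentedMonoid.lift (fun _ => Multiplicative.ofAdd 1) (by
    rintro _ _ ⟨n, k, h⟩
    simp)

/-- The length of an element of Thompson's monoid as a word in the generators. -/
def thompsonLength (p : ThompsonMonoid) : ℕ := (thompsonLengthHom p).toAdd

@[simp]
theorem thompsonLength_one : thompsonLength 1 = 0 := by simp [thompsonLength]

@[simp]
theorem thompsonLength_mul (p q : ThompsonMonoid) :
    thompsonLength (p * q) = thompsonLength p + thompsonLength q := by simp [thompsonLength]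

@[simp]
theorem thompsonLength_gen (n : ℕ) : thompsonLength (thompsonGen n) = 1 := rfl

theorem thompsonLength_eq_zero {p : ThompsonMonoid} : thompsonLength p = 0 ↔ p = 1 := by
  refine ⟨fun h => ?_, fun h => by simp [h]⟩
  induction p using thompson_induction with
  | one => rfl
  | gen_mul n q _ => simp at h

theorem thompsonGen_dvd_of_lt {i j : ℕ} (hij : i < j) {a b : ThompsonMonoid}
    (h : thompsonGen i * a = thompsonGen j * b) : ∃ c, b = thompsonGen i * c := by
  have h' := congrArg normalForm h
  rw [normalForm_gen_mul, normalForm_gen_mul] at h'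
  obtain ⟨w, hw⟩ := exists_eq_insertLetter hij h'
  refine ⟨wordProd w, ?_⟩
  rw [← wordProd_normalForm b, hw, wordProd_insertLetter]

theorem thompson_dvd_iff_gen_mul_dvd (n : ℕ) {a b : ThompsonMonoid} :
    thompsonGen n * a ∣ thompsonGen n * b ↔ a ∣ b := by
  refine ⟨fun ⟨c, hc⟩ => ⟨c, ?_⟩, mul_dvd_mul_left _⟩
  exact thompson_mul_left_cancel (thompsonGen n) _ _ (by rw [hc, mul_assoc])

/-- Distinct generators have a least common multiple, with residuals again generators. -/
theorem exists_gen_residual {i j : ℕ} (hij : i ≠ j) :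
    ∃ i' j', thompsonGen i * thompsonGen j' = thompsonGen j * thompsonGen i' ∧
      ∀ a b, thompsonGen i * a = thompsonGen j * b →
        ∃ c, a = thompsonGen j' * c ∧ b = thompsonGen i' * c := by
  rcases lt_or_gt_of_ne hij with h | h
  · refine ⟨i, j + 1, (thompsonGen_mul h).symm, fun a b hab => ?_⟩
    obtain ⟨c, rfl⟩ := thompsonGen_dvd_of_lt h hab
    refine ⟨c, thompson_mul_left_cancel (thompsonGen i) _ _ ?_, rfl⟩
    rw [hab, ← mul_assoc, ← mul_assoc, thompsonGen_mul h]
  · refine ⟨i + 1, j, thompsonGen_mul h, fun a b hab => ?_⟩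
    obtain ⟨c, rfl⟩ := thompsonGen_dvd_of_lt h hab.symm
    refine ⟨c, rfl, thompson_mul_left_cancel (thompsonGen j) _ _ ?_⟩
    rw [← hab, ← mul_assoc, ← mul_assoc, thompsonGen_mul h]

/-- The letters of q are peeled off one at a time. Passing x_i across a letter x_j replaces the pair
by x_j' and x_i' in the LCM square, or deletes the letter when i = j; each letter of q thus leaves
at most one letter in the residual. -/
theorem exists_residual_gen (i : ℕ) (q : ThompsonMonoid) :
    ∃ r, thompsonLength r ≤ thompsonLength q ∧ ∀ t, r ∣ t ↔ q ∣ thompsonGen i * t := by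
  induction q using thompson_induction generalizing i with
  | one => exact ⟨1, le_rfl, fun t => by simp⟩
  | gen_mul j q ih =>
    rcases eq_or_ne i j with rfl | hij
    · exact ⟨q, by simp, fun t => (thompson_dvd_iff_gen_mul_dvd i).symm⟩
    · obtain ⟨i', j', hcomm, hlcm⟩ := exists_gen_residual hij
      obtain ⟨r, hlen, hr⟩ := ih i'
      refine ⟨thompsonGen j' * r, by simpa using hlen, fun t => ⟨?_, ?_⟩⟩
      · rintro ⟨c, rfl⟩
        rw [mul_assoc, ← mul_assoc, hcomm, mul_assoc, thompson_dvd_iff_gen_mul_dvd, ← hr]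
        exact dvd_mul_right _ _
      · rintro ⟨v, hv⟩
        rw [mul_assoc] at hv
        obtain ⟨c, rfl, hc⟩ := hlcm _ _ hv
        rw [thompson_dvd_iff_gen_mul_dvd, hr]
        exact ⟨v, hc.symm⟩

theorem thompson_exists_residual (p q : ThompsonMonoid) :
    ∃ r, thompsonLength r ≤ thompsonLength q ∧ ∀ t, r ∣ t ↔ q ∣ p * t := by
  induction p using thompson_induction generalizing q with
  | one => exact ⟨q, le_rfl, fun t => by simp⟩
  | gen_mul i p ih =>
    obtain ⟨r, hlen, hr⟩ := exists_residual_gen i q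
    obtain ⟨s, hlen', hs⟩ := ih r
    exact ⟨s, hlen'.trans hlen, fun t => by rw [hs, hr, mul_assoc]⟩

instance : ResidualMonoid ThompsonMonoid where
  mul_left_cancel := thompson_mul_left_cancel
  dvd_antisymm p q := by
    rintro ⟨a, rfl⟩ ⟨b, hb⟩
    have h := congrArg thompsonLength hb
    simp only [thompsonLength_mul] at h
    rw [thompsonLength_eq_zero.1 (show thompsonLength a = 0 by omega), mul_one]
  exists_residual p q := (thompson_exists_residual p q).imp fun _ h => h.2

theorem thompsonLength_residual_le (p q : ThompsonMonoid) :
    thompsonLength (residual p q) ≤ thompsonLength q := by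
  obtain ⟨r, hlen, hr⟩ := thompson_exists_residual p q
  rwa [show residual p q = r from eq_of_dvd_iff fun t => by rw [residual_dvd_iff, hr]]

theorem thompson_factor (q : ThompsonMonoid) : q = 1 ∨ q ∈ Set.range thompsonGen ∨
    ∃ x y, q = x * y ∧ thompsonLength x < thompsonLength q ∧
      thompsonLength y < thompsonLength q := by
  induction q using thompson_induction with
  | one => exact Or.inl rfl
  | gen_mul n q _ =>
    by_cases hq : q = 1
    · exact Or.inr (Or.inl ⟨n, by rw [hq, mul_one]⟩)
    · have h0 : thompsonLength q ≠ 0 := fun h => hq (thompsonLength_eq_zero.1 h)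
      refine Or.inr (Or.inr ⟨thompsonGen n, q, rfl, ?_, ?_⟩) <;>
        rw [thompsonLength_mul, thompsonLength_gen] <;> omega

theorem thompson_descendingChainCondition : DescendingChainCondition ThompsonMonoid := by
  rintro ⟨x, y, h⟩
  have key : ∀ n, thompsonLength (x (n + 1)) < thompsonLength (x n) := fun n => by
    have hy : thompsonLength (y n) ≠ 0 := fun h0 =>
      (h n).1 (isUnit_iff_eq_one.2 (thompsonLength_eq_zero.1 h0))
    rcases (h n).2 with h' | h' <;> rw [h', thompsonLength_mul] <;> omega
  exact (RelEmbedding.natGT (r := (· < ·)) (fun n => thompsonLength (x n)) key).not_wellFounded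
    wellFounded_lt

theorem thompson_minimalElements : minimalElements ThompsonMonoid = Set.range thompsonGen := by
  ext p
  constructor
  · intro hp
    induction p using thompson_induction with
    | one => exact absurd isUnit_one hp.not_isUnit
    | gen_mul n q _ =>
      refine ⟨n, ?_⟩
      rcases hp.isUnit_or_isUnit rfl with h | h
      · have := congrArg thompsonLength (isUnit_iff_eq_one.1 h)
        simp at this
      · rw [isUnit_iff_eq_one.1 h, mul_one]
  · rintro ⟨n, rfl⟩
    refine ⟨fun h => ?_, fun a b hab => ?_⟩
    · have := congrArg thompsonLength (isUnit_iff_eq_one.1 h)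
      simp at this
    · have := congrArg thompsonLength hab
      simp only [thompsonLength_mul, thompsonLength_gen] at this
      simp only [isUnit_iff_eq_one, ← thompsonLength_eq_zero]
      omega

theorem thompson_join_gen {i j : ℕ} (hij : i < j) :
    join {thompsonGen i, thompsonGen j} = {thompsonGen j * thompsonGen i} := by
  rw [join_pair, Set.singleton_eq_singleton_iff]
  refine eq_of_dvd_iff fun t => ?_
  rw [mul_residual_dvd_iff]
  constructor
  · rintro ⟨⟨a, rfl⟩, b, hb⟩
    obtain ⟨c, rfl⟩ := thompsonGen_dvd_of_lt hij hb
    exact ⟨c, by rw [hb, mul_assoc]⟩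
  · intro h
    refine ⟨?_, (dvd_mul_right _ _).trans h⟩
    rw [thompsonGen_mul hij] at h
    exact (dvd_mul_right _ _).trans h

/-- The residual x_i⁻¹(x_i ∨ x_j) is x_{j+1}, 1 or x_j according as i < j, i = j or i > j. -/
theorem thompson_isMinimalSet : IsMinimalSet (Set.range thompsonGen) := by
  refine ⟨thompson_minimalElements.le, ?_⟩
  rw [thompson_minimalElements]
  rintro _ ⟨i, rfl⟩ _ ⟨j, rfl⟩ a ha
  rw [isUnit_iff_eq_one]
  rcases lt_trichotomy i j with h | rfl | h
  · rw [thompson_join_gen h, Set.mem_singleton_iff, thompsonGen_mul h] at ha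
    exact Or.inl ⟨_, (thompson_mul_left_cancel _ _ _ ha).symm⟩
  · rw [join_pair, Set.mem_singleton_iff, residual_self] at ha
    exact Or.inr (thompson_mul_left_cancel _ _ _ ha)
  · rw [Set.pair_comm, thompson_join_gen h, Set.mem_singleton_iff] at ha
    exact Or.inl ⟨_, (thompson_mul_left_cancel _ _ _ ha).symm⟩

end Thompson

/-! ### Inclusion-exclusion over finite sets -/

section Combinatorics

variable {ι M : Type*} [DecidableEq ι] [AddCommGroup M] [Module ℂ M]

theorem signedSum_insert {a : ι} {s : Finset ι} (ha : a ∉ s) (f : Finset ι → M) :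
    ∑ U ∈ (insert a s).powerset, (-1 : ℂ) ^ U.card • f U =
      ∑ U ∈ s.powerset, (-1 : ℂ) ^ U.card • f U -
        ∑ U ∈ s.powerset, (-1 : ℂ) ^ U.card • f (insert a U) := by
  rw [Finset.sum_powerset_insert ha, sub_eq_add_neg, ← Finset.sum_neg_distrib]
  congr 1
  refine Finset.sum_congr rfl fun U hU => ?_
  rw [Finset.card_insert_of_notMem fun h => ha (Finset.mem_powerset.1 hU h), pow_succ]
  simp

/-- For fixed W = U ∪ V each element of W lies in U only, in V only or in both, contributing -1 - 1
+ 1 = -1. -/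
theorem signedSum_union (F : Finset ι) (f : Finset ι → M) :
    ∑ U ∈ F.powerset, ∑ V ∈ F.powerset, (-1 : ℂ) ^ U.card • (-1 : ℂ) ^ V.card • f (U ∪ V) =
      ∑ W ∈ F.powerset, (-1 : ℂ) ^ W.card • f W := by
  induction F using Finset.induction_on generalizing f with
  | empty => simp
  | insert a F ha ih =>
    simp only [← Finset.smul_sum]
    rw [signedSum_insert ha, signedSum_insert ha, ← ih f, ← ih (fun W => f (insert a W))]
    simp only [signedSum_insert ha, Finset.insert_union, Finset.union_insert, Finset.insert_idem,
      sub_self, smul_zero, Finset.sum_const_zero, sub_zero, smul_sub, Finset.sum_sub_distrib,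
      Finset.smul_sum]

/-- Collecting terms by W = S ∪ U, the coefficient of f W is the alternating sum over U ⊆ W, which
vanishes unless W is empty. -/
theorem sum_signedSum_sdiff (s : Finset ι) (f : Finset ι → M) :
    ∑ S ∈ s.powerset, ∑ U ∈ (s \ S).powerset, (-1 : ℂ) ^ U.card • f (S ∪ U) = f ∅ := by
  induction s using Finset.induction_on generalizing f with
  | empty => simp
  | insert a s ha ih =>
    rw [Finset.sum_powerset_insert ha, ← Finset.sum_add_distrib]
    refine Eq.trans (Finset.sum_congr rfl fun S hS => ?_) (ih f)
    have haS : a ∉ S := fun h => ha (Finset.mem_powerset.1 hS h)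
    have h1 : insert a s \ S = insert a (s \ S) := Finset.insert_sdiff_of_notMem s haS
    have h2 : insert a s \ insert a S = s \ S := by
      rw [Finset.insert_sdiff_insert, Finset.sdiff_insert_of_notMem ha]
    rw [h1, h2, signedSum_insert (by simp [ha])]
    simp [Finset.union_insert, Finset.insert_union]

theorem sum_signedSum_sdiff_of_subset {B s : Finset ι} (hB : B ⊆ s) (f : Finset ι → M) :
    ∑ S ∈ s.powerset, (if B ⊆ S then ∑ U ∈ (s \ S).powerset, (-1 : ℂ) ^ U.card • f (S ∪ U)
      else 0) = f B := by
  have h := sum_signedSum_sdiff (s \ B) (fun W => f (B ∪ W))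
  rw [Finset.union_empty] at h
  rw [← h, ← Finset.sum_filter]
  have hset : s.powerset.filter (B ⊆ ·) = (s \ B).powerset.image (B ∪ ·) := by
    rw [← Finset.Icc_eq_image_powerset hB]
    ext S
    simp [and_comm]
  rw [hset, Finset.sum_image]
  · refine Finset.sum_congr rfl fun S _ => ?_
    rw [sdiff_sdiff_left, Finset.sup_eq_union]
    simp only [Finset.union_assoc]
  · intro S hS S' hS' h
    have aux : ∀ {R : Finset ι}, R ⊆ s \ B → (B ∪ R) \ B = R := fun {R} hR => by
      rw [Finset.union_sdiff_cancel_left]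
      exact (Finset.disjoint_of_subset_left hR Finset.sdiff_disjoint).symm
    simp only [Finset.coe_powerset, Set.mem_preimage, Set.mem_powerset_iff,
      Finset.coe_subset] at hS hS'
    rw [← aux hS, ← aux hS']
    exact congrArg (· \ B) h

end Combinatorics

/-! ### Brehmer sums and positivity of the kernel -/

section Operators

open ContinuousLinearMap

variable {H : Type*} [NormedAddCommGroup H] [InnerProductSpace ℂ H]

open scoped ComplexOrder in
-- Over ℂ, a real quadratic form already forces self-adjointness.
theorem isPositive_of_inner_nonneg {A : H →L[ℂ] H} (hA : ∀ h, 0 ≤ inner ℂ h (A h)) :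
    A.IsPositive := by
  rw [isPositive_iff_complex]
  intro h
  have h' : 0 ≤ inner ℂ (A h) h := by
    rw [← inner_conj_symm]
    exact star_nonneg_iff.2 (hA h)
  obtain ⟨h1, h2⟩ := Complex.nonneg_iff.1 h'
  refine ⟨Complex.ext rfl h2, h1⟩

variable [CompleteSpace H] {P : Type*} [Monoid P] [ResidualMonoid P] {ι : Type*}

theorem regularKernel_eq (T : P →* (H →L[ℂ] H)) {p q s : P} (h : s = p * residual p q) :
    regularKernel T p q = T (leftQuot p s) * adjoint (T (leftQuot q s)) := by
  have hne : (join {p, q}).Nonempty := by rw [join_pair]; exact Set.singleton_nonempty _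
  have hs : hne.some = s := by
    have := hne.some_mem
    rwa [h, ← Set.mem_singleton_iff, ← join_pair]
  rw [regularKernel, dif_pos hne, hs]

theorem conj_regularKernel (T : P →* (H →L[ℂ] H)) {p q s : P} (h : s = p * residual p q) :
    T p * regularKernel T p q * adjoint (T q) = T s * adjoint (T s) := by
  have hpq := mul_residual_dvd_iff.1 h.symm.dvd
  rw [regularKernel_eq T h]
  conv_rhs => rw [← mul_leftQuot_of_dvd hpq.1]
  conv_rhs => enter [2]; rw [mul_leftQuot_of_dvd hpq.1, ← mul_leftQuot_of_dvd hpq.2]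
  simp only [map_mul, ← star_eq_adjoint, star_mul, mul_assoc]

/-- The sum `∑_{U ⊆ s} (-1)^{|U|} TT*(∨_{i ∈ U} p i)` of an indexed family. -/
noncomputable def familyBrehmerSum (T : P →* (H →L[ℂ] H)) (s : Finset ι) (p : ι → P) :
    H →L[ℂ] H :=
  ∑ U ∈ s.powerset, (-1 : ℂ) ^ U.card • (T (familyLCM U p) * adjoint (T (familyLCM U p)))

theorem familyBrehmerSum_congr (T : P →* (H →L[ℂ] H)) {s : Finset ι} {p q : ι → P}
    (h : ∀ i ∈ s, p i = q i) : familyBrehmerSum T s p = familyBrehmerSum T s q :=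
  Finset.sum_congr rfl fun U hU => by
    rw [familyLCM_congr fun i hi => h i (Finset.mem_powerset.1 hU hi)]

theorem rangeJoin_image [DecidableEq P] (T : P →* (H →L[ℂ] H)) (U : Finset ι) (p : ι → P) :
    rangeJoin T (U.image p) = T (familyLCM U p) * adjoint (T (familyLCM U p)) := by
  have hne : (join (U.image p : Set P)).Nonempty := by
    rw [join_image]; exact Set.singleton_nonempty _
  have hs : hne.some = familyLCM U p :=
    Set.mem_singleton_iff.1 ((join_image U p).subset hne.some_mem)
  rw [rangeJoin, dif_pos hne, hs]

theorem brehmerSum_eq (T : P →* (H →L[ℂ] H)) (F : Finset P) :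
    brehmerSum T F = familyBrehmerSum T F id := by
  classical
  refine Finset.sum_congr rfl fun U _ => ?_
  rw [← rangeJoin_image, Finset.image_id]

theorem brehmerSum_image [DecidableEq P] (T : P →* (H →L[ℂ] H)) {s : Finset ι} {p : ι → P}
    (hp : Set.InjOn p s) : brehmerSum T (s.image p) = familyBrehmerSum T s p := by
  rw [brehmerSum, Finset.powerset_image, Finset.sum_image]
  · refine Finset.sum_congr rfl fun U hU => ?_
    rw [rangeJoin_image, Finset.card_image_of_injOn
      (hp.mono (Finset.coe_subset.2 (Finset.mem_powerset.1 hU)))]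
  · intro U hU V hV h
    simp only [Finset.coe_powerset, Set.mem_preimage, Set.mem_powerset_iff] at hU hV
    have h' := congrArg (fun W : Finset P => (W : Set P)) h
    simp only [Finset.coe_image] at h'
    exact Finset.coe_injective ((hp.image_eq_image_iff hU hV).1 h')

variable [DecidableEq ι]

theorem familyBrehmerSum_insert (T : P →* (H →L[ℂ] H)) {a : ι} {s : Finset ι} (ha : a ∉ s)
    (p : ι → P) :
    familyBrehmerSum T (insert a s) p = familyBrehmerSum T s p -
      T (p a) * familyBrehmerSum T s (fun i => residual (p a) (p i)) * adjoint (T (p a)) := by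
  rw [familyBrehmerSum, signedSum_insert ha, familyBrehmerSum, familyBrehmerSum,
    Finset.mul_sum, Finset.sum_mul]
  congr 1
  refine Finset.sum_congr rfl fun U _ => ?_
  simp only [familyLCM_insert, map_mul, ← star_eq_adjoint, star_mul, mul_assoc,
    Algebra.mul_smul_comm, Algebra.smul_mul_assoc]

/-- Adjoining an index with value 1 changes the sign of a term but not its LCM, so terms cancel in
pairs. -/
theorem familyBrehmerSum_eq_zero (T : P →* (H →L[ℂ] H)) {s : Finset ι} {p : ι → P} {a : ι}
    (ha : a ∈ s) (h : p a = 1) : familyBrehmerSum T s p = 0 := by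
  rw [← Finset.insert_erase ha, familyBrehmerSum_insert T (Finset.notMem_erase a s)]
  simp [h, residual_one, ← star_eq_adjoint]

/-- Generalizes I - T(xy)T(xy)* = (I - T(x)T(x)*) + T(x)(I - T(y)T(y)*)T(x)*. Expanding all three
sums at a, the middle terms telescope because the residual by xy is the residual by x followed by
that by y. -/
theorem familyBrehmerSum_mul (T : P →* (H →L[ℂ] H)) {s : Finset ι} {p : ι → P} {a : ι}
    (ha : a ∈ s) {x y : P} (h : p a = x * y) :
    familyBrehmerSum T s p = familyBrehmerSum T s (Function.update p a x) +
      T x * familyBrehmerSum T s (Function.update (fun i => residual x (p i)) a y) *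
        adjoint (T x) := by
  have hna := Finset.notMem_erase a s
  have hupd : ∀ (q : ι → P) (z : P), ∀ i ∈ s.erase a, Function.update q a z i = q i :=
    fun q z i hi => Function.update_of_ne (Finset.ne_of_mem_erase hi) _ _
  have hx : familyBrehmerSum T (s.erase a) (fun i => residual x (Function.update p a x i)) =
      familyBrehmerSum T (s.erase a) (fun i => residual x (p i)) :=
    familyBrehmerSum_congr T fun i hi => by rw [hupd p x i hi]
  have hy : familyBrehmerSum T (s.erase a) (fun i =>
        residual y (Function.update (fun i => residual x (p i)) a y i)) =
      familyBrehmerSum T (s.erase a) (fun i => residual y (residual x (p i))) :=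
    familyBrehmerSum_congr T fun i hi => by rw [hupd _ y i hi]
  rw [← Finset.insert_erase ha, familyBrehmerSum_insert T hna, familyBrehmerSum_insert T hna,
    familyBrehmerSum_insert T hna, Function.update_self, Function.update_self, hx, hy,
    familyBrehmerSum_congr T (hupd p x), familyBrehmerSum_congr T (hupd _ y), h]
  simp only [residual_mul, map_mul, ← star_eq_adjoint, star_mul, mul_sub, sub_mul, mul_assoc]
  abel

/-- Taking residuals and replacing factors may create repeated entries; this removes them. The
residual of one copy by the other is 1, which kills the correction term. -/
theorem familyBrehmerSum_erase (T : P →* (H →L[ℂ] H)) {s : Finset ι} {p : ι → P} {a b : ι}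
    (ha : a ∈ s) (hb : b ∈ s) (hab : a ≠ b) (h : p a = p b) :
    familyBrehmerSum T s p = familyBrehmerSum T (s.erase a) p := by
  have h1 : residual (p a) (p b) = 1 := by rw [h, residual_self]
  conv_lhs => rw [← Finset.insert_erase ha]
  rw [familyBrehmerSum_insert T (Finset.notMem_erase a s),
    familyBrehmerSum_eq_zero T (p := fun i => residual (p a) (p i))
      (Finset.mem_erase.2 ⟨hab.symm, hb⟩) h1]
  simp

/-- Positivity of the Brehmer sums over finite sets of generators passes to arbitrary finite
families, provided that residuals do not increase the length. -/
theorem familyBrehmerSum_isPositive (T : P →* (H →L[ℂ] H)) (G : Set P) (len : P → ℕ)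
    (hfactor : ∀ q : P, q = 1 ∨ q ∈ G ∨
      ∃ x y, q = x * y ∧ len x < len q ∧ len y < len q)
    (hlen : ∀ q ∈ G, 0 < len q) (hres : ∀ x q : P, len (residual x q) ≤ len q)
    (hT : ∀ F : Finset P, (F : Set P) ⊆ G → (brehmerSum T F).IsPositive)
    (s : Finset ι) (p : ι → P) : (familyBrehmerSum T s p).IsPositive := by
  classical
  -- Induction on the total length of the family.
  induction hn : ∑ i ∈ s, len (p i) using Nat.strong_induction_on generalizing s p with
  | _ n ih =>
  subst hn
  by_cases h1 : ∃ a ∈ s, p a = 1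
  · obtain ⟨a, ha, h⟩ := h1
    rw [familyBrehmerSum_eq_zero T ha h]
    exact isPositive_zero
  push Not at h1
  by_cases h2 : ∀ a ∈ s, p a ∈ G
  · by_cases hinj : Set.InjOn p s
    · rw [← brehmerSum_image T hinj]
      exact hT _ (by simpa [Set.subset_def] using h2)
    · simp only [Set.InjOn, not_forall, exists_prop] at hinj
      obtain ⟨a, ha, b, hb, hab, hne⟩ := hinj
      rw [familyBrehmerSum_erase T ha hb hne hab]
      refine ih _ ?_ _ _ rfl
      rw [← Finset.add_sum_erase s _ ha]
      have := hlen _ (h2 a ha)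
      omega
  · push Not at h2
    obtain ⟨a, ha, haG⟩ := h2
    obtain h | h | ⟨x, y, hxy, hx, hy⟩ := hfactor (p a)
    · exact absurd h (h1 a ha)
    · exact absurd h haG
    have hlt : ∀ (q : ι → P) (z : P), (∀ i, len (q i) ≤ len (p i)) → len z < len (p a) →
        ∑ i ∈ s, len (Function.update q a z i) < ∑ i ∈ s, len (p i) := by
      intro q z hq hz
      refine Finset.sum_lt_sum (fun i _ => ?_) ⟨a, ha, by rwa [Function.update_self]⟩
      rcases eq_or_ne i a with rfl | hi
      · rw [Function.update_self]; exact hz.le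
      · rw [Function.update_of_ne hi]; exact hq i
    -- Both summands have smaller total length: entry a becomes the shorter x or y, and passing to
    -- residuals by x lengthens no other entry.
    rw [familyBrehmerSum_mul T ha hxy]
    exact (ih _ (hlt _ _ (fun _ => le_rfl) hx) _ _ rfl).add
      ((ih _ (hlt _ _ (fun i => hres x (p i)) hy) _ _ rfl).conj_adjoint (T x))

/-- Möbius inversion for f(W) = T(p_i⁻¹ ∨W) T(p_j⁻¹ ∨W)*, whose value at W = {i, j} is the kernel.
For S containing i and j, the factorization of ∨(S ∪ U) gathers the inner sum over U into a Brehmer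
sum of residuals. -/
theorem regularKernel_eq_sum [Fintype ι] (T : P →* (H →L[ℂ] H)) (p : ι → P) (i j : ι) :
    regularKernel T (p i) (p j) = ∑ S : Finset ι, if i ∈ S ∧ j ∈ S then
      T (leftQuot (p i) (familyLCM S p)) *
        familyBrehmerSum T Sᶜ (fun k => residual (familyLCM S p) (p k)) *
        adjoint (T (leftQuot (p j) (familyLCM S p))) else 0 := by
  have hs : familyLCM {i, j} p = p i * residual (p i) (p j) := by
    rw [familyLCM_insert, familyLCM_singleton]
  rw [regularKernel_eq T hs, ← sum_signedSum_sdiff_of_subset (Finset.subset_univ {i, j})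
    (fun W => T (leftQuot (p i) (familyLCM W p)) * adjoint (T (leftQuot (p j) (familyLCM W p)))),
    Finset.powerset_univ]
  refine Finset.sum_congr rfl fun S _ => ?_
  have hiff : ({i, j} : Finset ι) ⊆ S ↔ i ∈ S ∧ j ∈ S := by
    simp [Finset.insert_subset_iff]
  rw [if_congr hiff rfl rfl]
  refine ite_congr rfl (fun h => ?_) fun _ => rfl
  rw [← Finset.compl_eq_univ_sdiff, familyBrehmerSum, Finset.mul_sum, Finset.sum_mul]
  refine Finset.sum_congr rfl fun U _ => ?_
  simp only [familyLCM_union, leftQuot_mul_of_dvd (dvd_familyLCM p h.1),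
    leftQuot_mul_of_dvd (dvd_familyLCM p h.2), map_mul, ← star_eq_adjoint, star_mul, mul_assoc,
    Algebra.mul_smul_comm, Algebra.smul_mul_assoc]

open scoped ComplexOrder in
theorem hasStarRegularDilation_of_familyBrehmerSum (T : P →* (H →L[ℂ] H))
    (hT : ∀ (n : ℕ) (s : Finset (Fin n)) (p : Fin n → P), (familyBrehmerSum T s p).IsPositive) :
    HasStarRegularDilation T := by
  intro n p h
  -- Summing over i and j first, each S contributes the quadratic form of one Brehmer sum at the
  -- single vector ∑_{i ∈ S} T(p_i⁻¹ ∨S)* h_i.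
  have key : ∑ i, ∑ j, inner ℂ (h i) (regularKernel T (p i) (p j) (h j)) =
      ∑ S : Finset (Fin n), inner ℂ
        (∑ i ∈ S, adjoint (T (leftQuot (p i) (familyLCM S p))) (h i))
        (familyBrehmerSum T Sᶜ (fun k => residual (familyLCM S p) (p k))
          (∑ j ∈ S, adjoint (T (leftQuot (p j) (familyLCM S p))) (h j))) := by
    have hij : ∀ i j, inner ℂ (h i) (regularKernel T (p i) (p j) (h j)) =
        ∑ S : Finset (Fin n), if i ∈ S ∧ j ∈ S then
          inner ℂ (adjoint (T (leftQuot (p i) (familyLCM S p))) (h i))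
            (familyBrehmerSum T Sᶜ (fun k => residual (familyLCM S p) (p k))
              (adjoint (T (leftQuot (p j) (familyLCM S p))) (h j))) else 0 := fun i j => by
      rw [regularKernel_eq_sum, sum_apply, inner_sum]
      refine Finset.sum_congr rfl fun S _ => ?_
      split_ifs
      · rw [adjoint_inner_left]
        rfl
      · simp
    simp only [hij]
    rw [Finset.sum_congr rfl fun i _ => Finset.sum_comm, Finset.sum_comm]
    refine Finset.sum_congr rfl fun S _ => ?_
    simp only [map_sum, sum_inner, inner_sum, ite_and]
    simp only [Finset.sum_ite_irrel, Finset.sum_ite_mem, Finset.univ_inter,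
      Finset.sum_const_zero]
    exact Finset.sum_comm
  rw [key]
  exact Finset.sum_nonneg fun S _ => (hT n _ _).inner_nonneg_right _

theorem HasStarRegularDilation.brehmerSum_isPositive {T : P →* (H →L[ℂ] H)}
    (hT : HasStarRegularDilation T) (F : Finset P) : (brehmerSum T F).IsPositive := by
  classical
  rw [brehmerSum_eq]
  refine isPositive_of_inner_nonneg fun h => ?_
  -- Positive definiteness is stated for families over `Fin n`, so the subsets of F are enumerated.
  let e := F.powerset.equivFin
  let v : Finset P → P := fun U => familyLCM U id
  have hpos := hT _ (fun i => v (e.symm i))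
    (fun i => (-1 : ℂ) ^ (e.symm i : Finset P).card • adjoint (T (v (e.symm i))) h)
  have hterm : ∀ U V : Finset P, inner ℂ ((-1 : ℂ) ^ U.card • adjoint (T (v U)) h)
      (regularKernel T (v U) (v V) ((-1 : ℂ) ^ V.card • adjoint (T (v V)) h)) =
      (-1 : ℂ) ^ U.card • (-1 : ℂ) ^ V.card •
        inner ℂ h ((T (v (U ∪ V)) * adjoint (T (v (U ∪ V)))) h) := by
    intro U V
    have hs : v (U ∪ V) = v U * residual (v U) (v V) := by
      refine eq_of_dvd_iff fun t => ?_
      simp only [v, mul_residual_dvd_iff, familyLCM_dvd_iff, Finset.mem_union, or_imp,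
        forall_and]
    rw [← conj_regularKernel T hs]
    simp only [map_smul, inner_smul_left, inner_smul_right, map_pow, map_neg, map_one,
      adjoint_inner_left, smul_eq_mul]
    rw [mul_left_comm]
    rfl
  have hsum : ∑ i, ∑ j, inner ℂ
      ((-1 : ℂ) ^ (e.symm i : Finset P).card • adjoint (T (v (e.symm i))) h)
      (regularKernel T (v (e.symm i)) (v (e.symm j))
        ((-1 : ℂ) ^ (e.symm j : Finset P).card • adjoint (T (v (e.symm j))) h)) =
      inner ℂ h (familyBrehmerSum T F id h) := by
    simp only [hterm]
    rw [e.symm.sum_comp (fun U : F.powerset => ∑ j, (-1 : ℂ) ^ (U : Finset P).card •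
      (-1 : ℂ) ^ (e.symm j : Finset P).card • inner ℂ h
        ((T (v (U ∪ e.symm j)) * adjoint (T (v (U ∪ e.symm j)))) h))]
    simp only [fun U : F.powerset => e.symm.sum_comp (fun V : F.powerset =>
      (-1 : ℂ) ^ (U : Finset P).card • (-1 : ℂ) ^ (V : Finset P).card • inner ℂ h
        ((T (v (U ∪ V)) * adjoint (T (v (U ∪ V)))) h))]
    rw [Finset.sum_coe_sort F.powerset (fun U => ∑ V : F.powerset, (-1 : ℂ) ^ U.card •
      (-1 : ℂ) ^ (V : Finset P).card • inner ℂ h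
        ((T (v (U ∪ V)) * adjoint (T (v (U ∪ V)))) h))]
    simp only [fun U : Finset P => Finset.sum_coe_sort F.powerset (fun V =>
      (-1 : ℂ) ^ U.card • (-1 : ℂ) ^ V.card • inner ℂ h
        ((T (v (U ∪ V)) * adjoint (T (v (U ∪ V)))) h))]
    -- The double sum depends on U ∪ V only up to signs, and collapses to the single Brehmer sum.
    rw [signedSum_union F (fun W => inner ℂ h ((T (v W) * adjoint (T (v W))) h)),
      familyBrehmerSum, sum_apply, inner_sum]
    simp only [smul_apply, inner_smul_right, smul_eq_mul, v]
  rw [← hsum]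
  exact hpos

end Operators

end RightLCM

theorem mainTheorem6 :
    RightLCM.IsRightLCM RightLCM.ThompsonMonoid ∧
    RightLCM.DescendingChainCondition RightLCM.ThompsonMonoid ∧
    RightLCM.minimalElements RightLCM.ThompsonMonoid = Set.range RightLCM.thompsonGen ∧
    RightLCM.IsMinimalSet (Set.range RightLCM.thompsonGen) ∧
    (∀ i j : ℕ, i < j →
      RightLCM.join {RightLCM.thompsonGen i, RightLCM.thompsonGen j} =
        {RightLCM.thompsonGen j * RightLCM.thompsonGen i}) ∧
    ∀ (H : Type*) [NormedAddCommGroup H] [InnerProductSpace ℂ H] [CompleteSpace H]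
      (T : RightLCM.ThompsonMonoid →* (H →L[ℂ] H)), (∀ p, ‖T p‖ ≤ 1) →
      (RightLCM.HasStarRegularDilation T ↔
        ∀ F : Finset RightLCM.ThompsonMonoid,
          (F : Set RightLCM.ThompsonMonoid) ⊆ Set.range RightLCM.thompsonGen →
            (RightLCM.brehmerSum T F).IsPositive) := by
  refine ⟨RightLCM.isRightLCM_of_residualMonoid, RightLCM.thompson_descendingChainCondition,
    RightLCM.thompson_minimalElements, RightLCM.thompson_isMinimalSet,
    fun i j hij => RightLCM.thompson_join_gen hij, fun H _ _ _ T _ => ?_⟩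
  refine ⟨fun hT F _ => hT.brehmerSum_isPositive F, fun hT => ?_⟩
  refine RightLCM.hasStarRegularDilation_of_familyBrehmerSum T fun n s p =>
    RightLCM.familyBrehmerSum_isPositive T (Set.range RightLCM.thompsonGen)
      RightLCM.thompsonLength RightLCM.thompson_factor ?_
      RightLCM.thompsonLength_residual_le hT s p
  rintro _ ⟨i, rfl⟩
  simp
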